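/- For a metric space $X$, the asymptotic dimension $\operatorname{asdim}(X)\in\mathbb{N}\cup\{\infty\}$ is the smallest $n$ such that for every $r>0$ there are $D<\infty$ and a cover of $X$ by sets of diameter at most $D$ such that every subset of $X$ of diameter at most $r$ meets at most $n+1$ sets of the cover (and $\infty$ if there is no such finite $n$). For a finitely generated group $G$, $\operatorname{asdim}(G)$ denotes the asymptotic dimension of $G$ with the word metric of a finite generating set. Theorem. Let $A$ and $C$ be finitely generated groups, let $i,j\colon C\to A$ be injective homomorphisms, and let $$A*_C=\langle A,t \mid t\,i(c)\,t^{-1}=j(c)\ \text{for all } c\in C\rangle$$ be the associated HNN extension. Then $A*_C$ is finitely generated, and $$\operatorname{asdim}(A*_C)\le\max\{\operatorname{asdim}(A),\ \operatorname{asdim}(C)+1\},$$ where each asymptotic dimension may be computed with any finite generating set of the group concerned. -/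

import Mathlib

namespace AsymptoticDimension

/-- The set `U` has diameter at most `D`. -/
def DiamLE {X : Type*} [PseudoMetricSpace X] (U : Set X) (D : ℝ) : Prop :=
  ∀ x ∈ U, ∀ y ∈ U, dist x y ≤ D

/-- The family `𝒰` is `D`-bounded: every member has diameter at most `D`. -/
def IsBoundedFamily {X : Type*} [PseudoMetricSpace X] (𝒰 : Set (Set X)) (D : ℝ) : Prop :=
  ∀ U ∈ 𝒰, DiamLE U D

/-- The `r`-multiplicity of `𝒰` is at most `m`: every subset of `X` of diameter at most `r`
meets at most `m` members of `𝒰`. -/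
def MultiplicityLE {X : Type*} [PseudoMetricSpace X] (𝒰 : Set (Set X)) (r : ℝ) (m : ℕ) : Prop :=
  ∀ B : Set X, DiamLE B r → {U ∈ 𝒰 | (U ∩ B).Nonempty}.encard ≤ m

/-- `asdim X ≤ n`: for every `r > 0` there are a `D < ∞` and a `D`-bounded cover of `X`
with `r`-multiplicity at most `n + 1`. -/
def AsdimLE (X : Type*) [PseudoMetricSpace X] (n : ℕ) : Prop :=
  ∀ r : ℝ, 0 < r → ∃ (D : ℝ) (𝒰 : Set (Set X)),
    ⋃₀ 𝒰 = Set.univ ∧ IsBoundedFamily 𝒰 D ∧ MultiplicityLE 𝒰 r (n + 1)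

/-- The asymptotic dimension: the smallest `n` such that `AsdimLE X n`, and `∞` if there is
no such `n`. -/
noncomputable def asdim (X : Type*) [PseudoMetricSpace X] : ℕ∞ :=
  ⨅ (n : ℕ) (_ : AsdimLE X n), (n : ℕ∞)

/-- `l` is a word in the letters `S ∪ S⁻¹`. -/
def IsWord {G : Type*} [Group G] (S : Set G) (l : List G) : Prop :=
  ∀ x ∈ l, x ∈ S ∨ x⁻¹ ∈ S

/-- The word length of `g`: the least length of a word in `S ∪ S⁻¹` that represents `g`
(meaningful when `S` generates `G`). -/
noncomputable def wordLength {G : Type*} [Group G] (S : Set G) (g : G) : ℕ :=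
  sInf {n : ℕ | ∃ l : List G, IsWord S l ∧ l.prod = g ∧ l.length = n}

section WordLength

variable {G : Type*} [Group G] {S : Set G}

theorem exists_isWord (hS : Subgroup.closure S = ⊤) (g : G) :
    ∃ l : List G, IsWord S l ∧ l.prod = g := by
  have hg : g ∈ (Subgroup.closure S).toSubmonoid := by
    rw [hS]
    exact Subgroup.mem_top g
  rw [Subgroup.closure_toSubmonoid] at hg
  obtain ⟨l, hl, hp⟩ := Submonoid.exists_list_of_mem_closure hg
  exact ⟨l, fun x hx => hl x hx, hp⟩

theorem exists_isWord_length (hS : Subgroup.closure S = ⊤) (g : G) :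
    ∃ l : List G, IsWord S l ∧ l.prod = g ∧ l.length = wordLength S g := by
  obtain ⟨l, hl, hg⟩ := exists_isWord hS g
  exact Nat.sInf_mem (s := {n : ℕ | ∃ l : List G, IsWord S l ∧ l.prod = g ∧ l.length = n})
    ⟨l.length, l, hl, hg, rfl⟩

theorem wordLength_prod_le {l : List G} (hl : IsWord S l) : wordLength S l.prod ≤ l.length :=
  Nat.sInf_le ⟨l, hl, rfl, rfl⟩

theorem wordLength_one : wordLength S (1 : G) = 0 := by
  have h : IsWord S ([] : List G) := by intro x hx; simp at hx
  simpa using wordLength_prod_le h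

theorem wordLength_inv_le (hS : Subgroup.closure S = ⊤) (g : G) :
    wordLength S g⁻¹ ≤ wordLength S g := by
  obtain ⟨l, hl, rfl, hn⟩ := exists_isWord_length hS g
  have h : IsWord S (l.map (·⁻¹)).reverse := by
    intro x hx
    simp only [List.mem_reverse, List.mem_map] at hx
    obtain ⟨y, hy, rfl⟩ := hx
    simpa using (hl y hy).symm
  rw [← hn, List.prod_inv_reverse]
  simpa using wordLength_prod_le h

theorem wordLength_inv (hS : Subgroup.closure S = ⊤) (g : G) :
    wordLength S g⁻¹ = wordLength S g :=
  le_antisymm (wordLength_inv_le hS g) (by simpa using wordLength_inv_le hS g⁻¹)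

theorem wordLength_mul_le (hS : Subgroup.closure S = ⊤) (g h : G) :
    wordLength S (g * h) ≤ wordLength S g + wordLength S h := by
  obtain ⟨l, hl, rfl, hn⟩ := exists_isWord_length hS g
  obtain ⟨k, hk, rfl, hm⟩ := exists_isWord_length hS h
  have hw : IsWord S (l ++ k) := by
    intro x hx
    rcases List.mem_append.1 hx with hx | hx
    exacts [hl x hx, hk x hx]
  rw [← hn, ← hm, ← List.prod_append, ← List.length_append]
  exact wordLength_prod_le hw

theorem eq_one_of_wordLength_eq_zero (hS : Subgroup.closure S = ⊤) {g : G}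
    (hg : wordLength S g = 0) : g = 1 := by
  obtain ⟨l, -, rfl, hn⟩ := exists_isWord_length hS g
  rw [hg, List.length_eq_zero_iff] at hn
  simp [hn]

end WordLength

/-- The (left-invariant) word metric `d(g, h) = |g⁻¹h|` on `G` for the generating set `S`. -/
noncomputable abbrev wordMetric {G : Type*} [Group G] (S : Set G)
    (hS : Subgroup.closure S = ⊤) : MetricSpace G where
  dist g h := (wordLength S (g⁻¹ * h) : ℝ)
  dist_self g := by simp [wordLength_one]
  dist_comm g h := by
    have := wordLength_inv hS (g⁻¹ * h)
    rw [mul_inv_rev, inv_inv] at this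
    rw [this]
  dist_triangle g h k := by
    have := wordLength_mul_le hS (g⁻¹ * h) (h⁻¹ * k)
    rw [show g⁻¹ * h * (h⁻¹ * k) = g⁻¹ * k by group] at this
    exact_mod_cast this
  eq_of_dist_eq_zero {g h} hgh := by
    have := eq_one_of_wordLength_eq_zero hS (g := g⁻¹ * h) (by exact_mod_cast hgh)
    exact inv_mul_eq_one.1 this

/-- The asymptotic dimension of `G` with the word metric of the generating set `S`. -/
noncomputable def groupAsdim {G : Type*} [Group G] (S : Set G)
    (hS : Subgroup.closure S = ⊤) : ℕ∞ :=
  @asdim G (wordMetric S hS).toPseudoMetricSpace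

/-- The HNN extension `A *_C` for two embeddings `i, j : C → A`, that is
`⟨A, t | t i(c) t⁻¹ = j(c) for c ∈ C⟩`. -/
abbrev HNN {A C : Type*} [Group A] [Group C] (i j : C →* A)
    (hi : Function.Injective i) (hj : Function.Injective j) : Type _ :=
  HNNExtension A i.range j.range
    ((MonoidHom.ofInjective hi).symm.trans (MonoidHom.ofInjective hj))

end AsymptoticDimension

open Relation

namespace AsymptoticDimension

/-! Asymptotic dimension at most `n` amounts to having, at each scale `r`, a coloring by `n + 1`
colors whose monochromatic `r`-components are bounded (`exists_coloring_of_asdimLE`,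
`asdimLE_of_coloring`). The Cayley graph of the HNN extension is a tree of spaces over the
Bass–Serre tree: vertex spaces are cosets of `A`, and the gates, where a vertex space touches its
parent, lie in cosets of `i(C)` or `j(C)` (`HNNExtension.isTreeOfSpaces`,
`HNNExtension.exists_gate_subset`). If `N` is the claimed bound, vertex spaces need at most `N + 1`
colors and gates at most `N`.

The heart is `IsTreeOfSpaces.exists_coloring`. Cut the tree at the levels divisible by a large `M`
and surround each gate there by a shell, which is coarsely the gate and so takes `N` colors. The
spare color is spent on separation: slice the shell into `N + 1` layers by distance to the gate and
shift the colors so that layer `i` omits color `i`. A component of color `i` cannot cross layer `i`,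
hence crosses no shell. It is confined to a region of bounded height, colored by
`uniformlyColorable_below`, and parts of adjacent shells; `IsColoring.union` glues the two
colorings. -/

/-- `d` is a pseudometric with natural values. -/
structure IsNatMetric {X : Type*} (d : X → X → ℕ) : Prop where
  self : ∀ x, d x x = 0
  comm : ∀ x y, d x y = d y x
  triangle : ∀ x y z, d x z ≤ d x y + d y z

/-- A step of length at most `r` between points of `S` of the same color. -/
def MonoStep {X : Type*} (d : X → X → ℕ) (S : Set X) (c : X → ℕ) (r : ℕ) (a b : X) : Prop :=
  a ∈ S ∧ b ∈ S ∧ c a = c b ∧ d a b ≤ r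

/-- The coloring `c` of `S` has `D`-bounded monochromatic `r`-components. -/
def IsColoring {X : Type*} (d : X → X → ℕ) (S : Set X) (c : X → ℕ) (r D : ℕ) : Prop :=
  ∀ x y, ReflTransGen (MonoStep d S c r) x y → d x y ≤ D

/-- The family `F` has, at every scale, colorings with `k` colors and uniformly bounded
monochromatic components, that is, asymptotic dimension at most `k - 1` uniformly. -/
def UniformlyColorable {X ι : Type*} (d : X → X → ℕ) (F : ι → Set X) (k : ℕ) : Prop :=
  ∀ r : ℕ, ∃ D : ℕ, ∀ i, ∃ c : X → ℕ, (∀ x, c x < k) ∧ IsColoring d (F i) c r D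

/-- The closed `s`-neighbourhood of `S`. -/
def neighborhood {X : Type*} (d : X → X → ℕ) (S : Set X) (s : ℕ) : Set X :=
  {x | ∃ y ∈ S, d x y ≤ s}

/-! ### Calculus of colorings with bounded components. -/

section Coloring

variable {X Y ι : Type*} {d : X → X → ℕ} {d' : Y → Y → ℕ} {S T P Q : Set X} {c : X → ℕ}
  {r D : ℕ}

theorem MonoStep.symm (hd : IsNatMetric d) {a b : X} (h : MonoStep d S c r a b) :
    MonoStep d S c r b a :=
  ⟨h.2.1, h.1, h.2.2.1.symm, hd.comm a b ▸ h.2.2.2⟩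

theorem chain_symm (hd : IsNatMetric d) {a b : X} (h : ReflTransGen (MonoStep d S c r) a b) :
    ReflTransGen (MonoStep d S c r) b a :=
  haveI : Std.Symm (MonoStep d S c r) := ⟨fun _ _ h => h.symm hd⟩
  symm h

theorem chain_eq_or_mem {a b : X} (h : ReflTransGen (MonoStep d S c r) a b) :
    a = b ∨ (a ∈ S ∧ b ∈ S) := by
  induction h with
  | refl => exact Or.inl rfl
  | tail _ h ih =>
    rcases ih with rfl | ih
    exacts [Or.inr ⟨h.1, h.2.1⟩, Or.inr ⟨ih.1, h.2.1⟩]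

theorem chain_map_eq {L : Type*} {lab : X → L}
    (hlab : ∀ a b, MonoStep d S c r a b → lab a = lab b)
    {a b : X} (h : ReflTransGen (MonoStep d S c r) a b) : lab a = lab b := by
  induction h with
  | refl => rfl
  | tail _ h ih => exact ih.trans (hlab _ _ h)

theorem IsColoring.of_label (hd : IsNatMetric d) {L : Type*} (lab : X → L)
    (hlab : ∀ a b, MonoStep d S c r a b → lab a = lab b)
    (hD : ∀ a ∈ S, ∀ b ∈ S, lab a = lab b → d a b ≤ D) : IsColoring d S c r D := by
  intro x y h
  rcases chain_eq_or_mem h with rfl | ⟨hx, hy⟩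
  · simp [hd.self]
  · exact hD x hx y hy (chain_map_eq hlab h)

theorem IsColoring.mono_bound {D' : ℕ} (h : IsColoring d S c r D) (hD : D ≤ D') :
    IsColoring d S c r D' :=
  fun x y hxy => (h x y hxy).trans hD

theorem IsColoring.pullback (hd : IsNatMetric d) {f : X → Y} {T : Set Y} {c : Y → ℕ}
    {r D R D' : ℕ} (hc : IsColoring d' T c R D) (hST : ∀ a ∈ S, f a ∈ T)
    (hr : ∀ a ∈ S, ∀ b ∈ S, d a b ≤ r → d' (f a) (f b) ≤ R)
    (hD : ∀ a ∈ S, ∀ b ∈ S, d' (f a) (f b) ≤ D → d a b ≤ D') :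
    IsColoring d S (fun x => c (f x)) r D' := by
  intro x y h
  rcases chain_eq_or_mem h with rfl | ⟨hx, hy⟩
  · simp [hd.self]
  · exact hD x hx y hy (hc _ _ (h.lift f fun a b h =>
      ⟨hST a h.1, hST b h.2.1, h.2.2.1, hr a h.1 b h.2.1 h.2.2.2⟩))

theorem IsColoring.recolor {c' : X → ℕ} (h : IsColoring d T c r D) (hST : S ⊆ T)
    (hcc : ∀ a ∈ S, ∀ b ∈ S, c' a = c' b → c a = c b) : IsColoring d S c' r D := by
  intro x y hxy
  exact h x y (ReflTransGen.mono (fun a b h =>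
    ⟨hST h.1, hST h.2.1, hcc a h.1 b h.2.1 h.2.2.1, h.2.2.2⟩) _ _ hxy)

theorem IsColoring.congr {c' : X → ℕ} (h : IsColoring d T c r D) (hST : S ⊆ T)
    (hcc : ∀ x ∈ S, c' x = c x) : IsColoring d S c' r D :=
  h.recolor hST fun a ha b hb hab => by rw [← hcc a ha, ← hcc b hb, hab]

/-- If `lab` is constant along monochromatic steps, then boundedness can be checked on the
fibers of `lab`. -/
theorem IsColoring.of_fibers {L : Type*} (lab : X → L)
    (hlab : ∀ a b, MonoStep d S c r a b → lab a = lab b)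
    (h : ∀ l, IsColoring d {x ∈ S | lab x = l} c r D) : IsColoring d S c r D := by
  intro x y hxy
  refine h (lab x) x y ?_
  induction hxy with
  | refl => exact .refl
  | tail h1 h2 ih =>
    have e := chain_map_eq hlab h1
    exact ih.tail ⟨⟨h2.1, e.symm⟩, ⟨h2.2.1, (e.trans (hlab _ _ h2)).symm⟩, h2.2.2⟩

/-- The saturated union of a coloring at a small scale and a coloring at a large scale. -/
theorem IsColoring.union (hd : IsNatMetric d) {D₁ D₂ : ℕ} (hP : IsColoring d P c r D₁)
    (hQ : IsColoring d Q c (D₁ + 2 * r) D₂) :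
    IsColoring d (P ∪ Q) c r (2 * (D₁ + D₂ + r)) := by
  have key : ∀ q ∈ Q, ∀ y, ReflTransGen (MonoStep d (P ∪ Q) c r) q y →
      d q y ≤ D₁ + D₂ + r := by
    intro q hq y h
    -- An excursion into `P` between two points of `Q` has diameter at most `D₁` and is entered and
    -- left by steps of length `r`, so it shortcuts to one step in `Q`. The second alternative
    -- remembers the last point `z` of `Q` and the entry point `y'` of the current excursion.
    have inv : (y ∈ Q ∧ ReflTransGen (MonoStep d Q c (D₁ + 2 * r)) q y) ∨
        (y ∈ P ∧ ∃ y' z, ReflTransGen (MonoStep d P c r) y' y ∧ z ∈ Q ∧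
          ReflTransGen (MonoStep d Q c (D₁ + 2 * r)) q z ∧ d z y' ≤ r ∧ c z = c y) := by
      induction h with
      | refl => exact Or.inl ⟨hq, .refl⟩
      | @tail y w _ hs ih =>
        obtain ⟨-, hw, hcw, hdw⟩ := hs
        rcases ih with ⟨hy, h⟩ | ⟨hy, y', z, h1, hz, h2, h3, h4⟩
        · rcases hw with hw | hw
          · exact Or.inr ⟨hw, w, y, .refl, hy, h, hdw, hcw⟩
          · exact Or.inl ⟨hw, h.tail ⟨hy, hw, hcw, by omega⟩⟩
        · rcases hw with hw | hw
          · exact Or.inr ⟨hw, y', z, h1.tail ⟨hy, hw, hcw, hdw⟩, hz, h2, h3, h4.trans hcw⟩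
          · refine Or.inl ⟨hw, h2.tail ⟨hz, hw, h4.trans hcw, ?_⟩⟩
            have := hP _ _ h1
            have := hd.triangle z y' w
            have := hd.triangle y' y w
            omega
    rcases inv with ⟨-, h⟩ | ⟨-, y', z, h1, -, h2, h3, -⟩
    · have := hQ _ _ h
      omega
    · have := hP _ _ h1
      have := hQ _ _ h2
      have := hd.triangle q z y
      have := hd.triangle z y' y
      omega
  intro x y hxy
  by_cases hq : ∃ q ∈ Q, ReflTransGen (MonoStep d (P ∪ Q) c r) q x
  · obtain ⟨q, hq, h⟩ := hq
    have := key q hq x h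
    have := key q hq y (h.trans hxy)
    have := hd.triangle x q y
    have := hd.comm x q
    omega
  · refine (hP x y ?_).trans (by omega)
    have hsub : ∀ z, ReflTransGen (MonoStep d (P ∪ Q) c r) x z → z ∉ Q :=
      fun z hz hzQ => hq ⟨z, hzQ, chain_symm hd hz⟩
    induction hxy with
    | refl => exact .refl
    | tail h1 h2 ih =>
      exact ih.tail ⟨h2.1.resolve_right (hsub _ h1),
        h2.2.1.resolve_right (hsub _ (h1.tail h2)), h2.2.2⟩

theorem UniformlyColorable.mono {κ : Type*} {F : ι → Set X} {F' : κ → Set X} {k k' : ℕ}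
    (h : UniformlyColorable d F k) (hF : ∀ j, ∃ i, F' j ⊆ F i) (hk : k ≤ k') :
    UniformlyColorable d F' k' := by
  intro r
  obtain ⟨D, hD⟩ := h r
  refine ⟨D, fun j => ?_⟩
  obtain ⟨i, hi⟩ := hF j
  obtain ⟨c, hc, hc'⟩ := hD i
  exact ⟨c, fun x => (hc x).trans_le hk, hc'.congr hi fun _ _ => rfl⟩

/-- Uniform colorability pulls back along uniformly coarse embeddings. -/
theorem UniformlyColorable.pullback {κ : Type*} (hd : IsNatMetric d) {F : ι → Set X}
    {F' : κ → Set Y} {k : ℕ} (h : UniformlyColorable d' F' k) (f : ι → X → Y)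
    (hF : ∀ i, ∃ j, ∀ x ∈ F i, f i x ∈ F' j)
    (hr : ∀ r, ∃ R, ∀ i, ∀ a ∈ F i, ∀ b ∈ F i, d a b ≤ r → d' (f i a) (f i b) ≤ R)
    (hD : ∀ D, ∃ D', ∀ i, ∀ a ∈ F i, ∀ b ∈ F i, d' (f i a) (f i b) ≤ D → d a b ≤ D') :
    UniformlyColorable d F k := by
  intro r
  obtain ⟨R, hR⟩ := hr r
  obtain ⟨D, hD₁⟩ := h R
  obtain ⟨D', hD'⟩ := hD D
  refine ⟨D', fun i => ?_⟩
  obtain ⟨j, hj⟩ := hF i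
  obtain ⟨c, hc, hc'⟩ := hD₁ j
  exact ⟨fun x => c (f i x), fun x => hc _, hc'.pullback hd hj (hR i) (hD' i)⟩

theorem UniformlyColorable.neighborhood (hd : IsNatMetric d) {F : ι → Set X} {k : ℕ}
    (h : UniformlyColorable d F k) (s : ℕ) :
    UniformlyColorable d (fun i => neighborhood d (F i) s) k := by
  have hp : ∀ i x, ∃ y, x ∈ AsymptoticDimension.neighborhood d (F i) s → y ∈ F i ∧ d x y ≤ s := by
    intro i x
    by_cases hx : x ∈ AsymptoticDimension.neighborhood d (F i) s
    · obtain ⟨y, hy⟩ := hx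
      exact ⟨y, fun _ => hy⟩
    · exact ⟨x, fun h => absurd h hx⟩
  choose f hf using hp
  refine h.pullback hd f (fun i => ⟨i, fun x hx => (hf i x hx).1⟩)
    (fun r => ⟨r + 2 * s, fun i a ha b hb hab => ?_⟩)
    (fun D => ⟨D + 2 * s, fun i a ha b hb hab => ?_⟩)
  all_goals
    have h1 := (hf i a ha).2
    have h2 := (hf i b hb).2
  · have := hd.triangle (f i a) a (f i b)
    have := hd.triangle a b (f i b)
    have := hd.comm (f i a) a
    omega
  · have := hd.triangle a (f i a) b
    have := hd.triangle (f i a) (f i b) b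
    have := hd.comm (f i b) b
    omega

end Coloring

/-! ### Covers of bounded multiplicity versus colorings. -/

section AsdimLE

variable {X : Type*} [PseudoMetricSpace X] {d : X → X → ℕ}

theorem isNatMetric_of_dist (hd : ∀ x y, dist x y = d x y) : IsNatMetric d where
  self x := by exact_mod_cast (hd x x).symm.trans (dist_self x)
  comm x y := by exact_mod_cast (hd x y).symm.trans ((dist_comm x y).trans (hd y x))
  triangle x y z := by
    have := dist_triangle x y z
    rw [hd, hd, hd] at this
    exact_mod_cast this

/-- The monochromatic components form the cover: a set of diameter at most `r` meets at most one
component of each color. -/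
theorem asdimLE_of_coloring (hd : ∀ x y, dist x y = d x y) {n : ℕ}
    (h : ∀ r : ℕ, ∃ D : ℕ, ∃ c : X → ℕ, (∀ x, c x < n + 1) ∧ IsColoring d Set.univ c r D) :
    AsdimLE X n := by
  have hm := isNatMetric_of_dist hd
  intro r _
  obtain ⟨D, c, hc, hD⟩ := h ⌈r⌉₊
  set comp : X → Set X := fun x => {y | ReflTransGen (MonoStep d Set.univ c ⌈r⌉₊) x y}
    with hcomp
  have comp_eq : ∀ x y, ReflTransGen (MonoStep d Set.univ c ⌈r⌉₊) x y → comp x = comp y :=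
    fun x y h => Set.ext fun z => ⟨fun hz => (chain_symm hm h).trans hz, fun hz => h.trans hz⟩
  refine ⟨D, Set.range comp, ?_, ?_, ?_⟩
  · exact Set.eq_univ_of_forall fun x => ⟨comp x, ⟨x, rfl⟩, .refl⟩
  · rintro _ ⟨x, rfl⟩ y hy z hz
    rw [hd]
    exact_mod_cast hD y z ((chain_symm hm hy).trans hz)
  · intro B hB
    have hch : ∀ U ∈ {U ∈ Set.range comp | (U ∩ B).Nonempty}, ∃ b ∈ B, comp b = U := by
      rintro _ ⟨⟨x, rfl⟩, b, hb, hbB⟩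
      exact ⟨b, hbB, (comp_eq x b hb).symm⟩
    rcases isEmpty_or_nonempty X with hX | hX
    · rw [Set.encard_eq_zero.2]
      · exact zero_le
      · exact Set.eq_empty_of_forall_notMem fun U hU => hX.elim (hch U hU).choose
    choose! f hf using hch
    calc _ ≤ (Set.Iio (n + 1)).encard := by
          refine Set.encard_le_encard_of_injOn (f := fun U => c (f U))
            (fun U _ => hc _) fun U hU V hV hUV => ?_
          rw [← (hf U hU).2, ← (hf V hV).2]
          refine comp_eq _ _ (.single ⟨trivial, trivial, hUV, ?_⟩)
          have := hB _ (hf U hU).1 _ (hf V hV).1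
          rw [hd] at this
          exact_mod_cast this.trans (Nat.le_ceil r)
      _ = _ := by
          rw [← Finset.coe_Iio, Set.encard_coe_eq_coe_finsetCard, Nat.card_Iio]

/-- A monotone sequence of `n + 2` natural numbers in `[1, n + 1]` has a repetition. -/
theorem exists_eq_succ_of_monotone {n : ℕ} {a : ℕ → ℕ} (h0 : 1 ≤ a 0)
    (hn : a (n + 1) ≤ n + 1) (ha : ∀ j, a j ≤ a (j + 1)) : ∃ j ≤ n, a j = a (j + 1) := by
  by_contra! hne
  have : ∀ j ≤ n + 1, j + 1 ≤ a j := by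
    intro j
    induction j with
    | zero => intro _; simpa using h0
    | succ j ih =>
      intro hj
      have := ih (by omega)
      have := ha j
      have := hne j (by omega)
      omega
  have := this (n + 1) le_rfl
  omega

/-- The members of the cover within `j * r` of `x` form an increasing chain in `j` that must stall
at some `J x ≤ n`. The color of `x` is the size of the stalled set, less one. For close points the
stalled sets are nested, so equal size forces equality. -/
theorem exists_coloring_of_asdimLE (hd : ∀ x y, dist x y = d x y) {n : ℕ} (h : AsdimLE X n)
    (r : ℕ) : ∃ D : ℕ, ∃ c : X → ℕ, (∀ x, c x < n + 1) ∧ IsColoring d Set.univ c r D := by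
  have hm := isNatMetric_of_dist hd
  -- A ball of radius `(n + 1) * r` must be a test set; the extra `1` keeps the scale positive when
  -- `r = 0`.
  obtain ⟨D, 𝒰, hcov, hbd, hmul⟩ := h (2 * (n + 1) * r + 1) (by positivity)
  let T : X → ℕ → Set (Set X) := fun x j => {U ∈ 𝒰 | ∃ u ∈ U, d x u ≤ j * r}
  have hTmono : ∀ x j, T x j ⊆ T x (j + 1) := by
    rintro x j U ⟨hU, u, hu, hxu⟩
    exact ⟨hU, u, hu, hxu.trans (Nat.mul_le_mul_right r (Nat.le_succ j))⟩
  have hTmono' : ∀ x i j, i ≤ j → T x i ⊆ T x j := fun x i j hij =>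
    monotone_nat_of_le_succ (f := T x) (hTmono x) hij
  have hTstep : ∀ x y j, d x y ≤ r → T x j ⊆ T y (j + 1) := by
    rintro x y j hxy U ⟨hU, u, hu, hxu⟩
    refine ⟨hU, u, hu, ?_⟩
    have := hm.triangle y x u
    have := hm.comm x y
    rw [add_mul, one_mul]
    omega
  have hTcard : ∀ x, (T x (n + 1)).encard ≤ n + 1 := by
    intro x
    have hB : DiamLE {y | d x y ≤ (n + 1) * r} (2 * (n + 1) * r + 1) := ?_
    · have := hmul _ hB
      push_cast at this
      refine le_trans (Set.encard_le_encard ?_) this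
      rintro U ⟨hU, u, hu, hxu⟩
      exact ⟨hU, u, hu, hxu⟩
    · intro y hy z hz
      have h1 := hm.triangle y x z
      have h2 := hm.comm x y
      have hy' : d x y ≤ (n + 1) * r := hy
      have hz' : d x z ≤ (n + 1) * r := hz
      have h3 : d y z ≤ 2 * (n + 1) * r + 1 := by
        have : 2 * (n + 1) * r = (n + 1) * r + (n + 1) * r := by ring
        omega
      rw [hd]
      exact_mod_cast h3
  have hTfin' : ∀ x, (T x (n + 1)).Finite := fun x =>
    Set.finite_of_encard_le_coe (k := n + 1) (by exact_mod_cast hTcard x)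
  have hTfin : ∀ x j, j ≤ n + 1 → (T x j).Finite := fun x j hj =>
    (hTfin' x).subset (hTmono' x _ _ hj)
  have hTncard : ∀ x, (T x (n + 1)).ncard ≤ n + 1 := by
    intro x
    have := hTcard x
    rw [← (hTfin' x).cast_ncard_eq] at this
    exact_mod_cast this
  have hTne : ∀ x, (T x 0).Nonempty := by
    intro x
    obtain ⟨U, hU, hx⟩ := Set.mem_sUnion.1 (hcov ▸ Set.mem_univ x)
    exact ⟨U, hU, x, hx, by simp [hm.self]⟩
  have hgap : ∀ x, ∃ j ≤ n, T x j = T x (j + 1) := by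
    intro x
    -- Truncating at `n + 1` keeps the sets finite, so that `ncard` is monotone at every index.
    obtain ⟨j, hj, he⟩ := exists_eq_succ_of_monotone (n := n)
      (a := fun j => (T x (min j (n + 1))).ncard)
      ((Set.ncard_pos (hTfin x _ (by omega))).2 (by simpa using hTne x))
      (by simpa using hTncard x)
      (fun j => Set.ncard_le_ncard (hTmono' x _ _ (by omega)) (hTfin x _ (by omega)))
    refine ⟨j, hj, Set.eq_of_subset_of_ncard_le (hTmono x j) ?_ (hTfin x _ (by omega))⟩
    simp only [min_eq_left (show j ≤ n + 1 by omega),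
      min_eq_left (show j + 1 ≤ n + 1 by omega)] at he
    exact he.ge
  choose J hJn hJ using hgap
  have hpos : ∀ x, 0 < (T x (J x)).ncard := fun x =>
    (Set.ncard_pos (hTfin x _ ((hJn x).trans (Nat.le_succ n)))).2
      ((hTne x).mono (hTmono' x _ _ (Nat.zero_le _)))
  have hle : ∀ x, (T x (J x)).ncard ≤ n + 1 := fun x =>
    (Set.ncard_le_ncard (hTmono' x _ _ ((hJn x).trans (Nat.le_succ n))) (hTfin' x)).trans
      (hTncard x)
  refine ⟨⌈D⌉₊ + 2 * (n * r), fun x => (T x (J x)).ncard - 1, fun x => ?_,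
    .of_label hm (fun x => T x (J x)) ?_ ?_⟩
  · have := hpos x
    have := hle x
    show (T x (J x)).ncard - 1 < n + 1
    omega
  · have main : ∀ a b, d a b ≤ r → J a ≤ J b → (T a (J a)).ncard = (T b (J b)).ncard →
        T a (J a) = T b (J b) := by
      intro a b hab hJab hcard
      refine Set.eq_of_subset_of_ncard_le ?_ hcard.ge
        (hTfin b _ ((hJn b).trans (Nat.le_succ n)))
      calc T a (J a) ⊆ T b (J a + 1) := hTstep a b _ hab
        _ ⊆ T b (J b + 1) := hTmono' b _ _ (by omega)
        _ = T b (J b) := (hJ b).symm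
    rintro a b ⟨-, -, hc, hab⟩
    have hcard : (T a (J a)).ncard = (T b (J b)).ncard := by
      have := hpos a
      have := hpos b
      have hc' : (T a (J a)).ncard - 1 = (T b (J b)).ncard - 1 := hc
      omega
    rcases le_total (J a) (J b) with h | h
    · exact main a b hab h hcard
    · exact (main b a (hm.comm a b ▸ hab) h hcard.symm).symm
  · intro a _ b _ (hlab : T a (J a) = T b (J b))
    obtain ⟨U, hU⟩ := (hTne a).mono (hTmono' a _ _ (Nat.zero_le (J a)))
    have hU' := hU
    rw [hlab] at hU'
    obtain ⟨hU0, u, hu, hau⟩ := hU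
    obtain ⟨-, w, hw, hbw⟩ := hU'
    have h1 : d u w ≤ ⌈D⌉₊ := by
      have := hbd U hU0 u hu w hw
      rw [hd] at this
      exact_mod_cast this.trans (Nat.le_ceil D)
    have := Nat.mul_le_mul_right r (hJn a)
    have := Nat.mul_le_mul_right r (hJn b)
    have := hm.triangle a u b
    have := hm.triangle u w b
    have := hm.comm b w
    omega

end AsdimLE

/-! ### Trees of spaces. -/

/-- A graph-like metric space `X` decomposed over a rooted forest with vertex set `V`, level
function `ℓ` and parent function `par`: adjacent points lie over the same vertex or over a vertex
and its parent. -/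
structure IsTreeOfSpaces {X V : Type*} (d : X → X → ℕ) (π : X → V) (ℓ : V → ℕ) (par : V → V) :
    Prop where
  metric : IsNatMetric d
  eq_of_dist_eq_zero : ∀ x y, d x y = 0 → x = y
  geodesic : ∀ x y n, d x y ≤ n + 1 → ∃ z, d x z ≤ 1 ∧ d z y ≤ n
  adj : ∀ x y, d x y ≤ 1 → π x = π y ∨ (ℓ (π x) = ℓ (π y) + 1 ∧ par (π x) = π y) ∨
    (ℓ (π y) = ℓ (π x) + 1 ∧ par (π y) = π x)
  exists_gate : ∀ v, 0 < ℓ v → ∃ e z, π e = v ∧ π z = par v ∧ d e z ≤ 1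
  level_par : ∀ v, 0 < ℓ v → ℓ (par v) + 1 = ℓ v

/-- The points over `v` that are adjacent to points over the parent of `v`. -/
def gate {X V : Type*} (d : X → X → ℕ) (π : X → V) (par : V → V) (v : V) : Set X :=
  {e | π e = v ∧ ∃ z, π z = par v ∧ d e z ≤ 1}

/-- The ancestor of `u` at level `k`. -/
def ancestor {V : Type*} (ℓ : V → ℕ) (par : V → V) (k : ℕ) (u : V) : V :=
  par^[ℓ u - k] u

/-- The points over descendants of `v` at most `m` levels below `v`. -/
def below {X V : Type*} (π : X → V) (ℓ : V → ℕ) (par : V → V) (m : ℕ) (v : V) : Set X :=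
  {x | ℓ v ≤ ℓ (π x) ∧ ℓ (π x) ≤ ℓ v + m ∧ ancestor ℓ par (ℓ v) (π x) = v}

/-- The distance to the gate of `v`. -/
noncomputable def depth {X V : Type*} (d : X → X → ℕ) (π : X → V) (par : V → V) (v : V) (x : X) :
    ℕ :=
  sInf {n | ∃ e ∈ gate d π par v, d x e ≤ n}

section Forest

variable {V : Type*} {ℓ : V → ℕ} {par : V → V}

theorem ancestor_self (u : V) : ancestor ℓ par (ℓ u) u = u := by simp [ancestor]

theorem ancestor_of_level_eq {u w : V} {k : ℕ} (h : ℓ u = ℓ w + 1) (hp : par u = w)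
    (hk : k ≤ ℓ w) : ancestor ℓ par k u = ancestor ℓ par k w := by
  unfold ancestor
  rw [h, show ℓ w + 1 - k = (ℓ w - k) + 1 by omega, Function.iterate_succ_apply, hp]

theorem level_ancestor (hp : ∀ v, 0 < ℓ v → ℓ (par v) + 1 = ℓ v) (k : ℕ) (u : V)
    (hk : k ≤ ℓ u) : ℓ (ancestor ℓ par k u) = k := by
  obtain ⟨m, hm⟩ := Nat.exists_eq_add_of_le hk
  induction m generalizing u with
  | zero =>
    have : k = ℓ u := by omega
    rw [this, ancestor_self]
  | succ m ih =>
    have h := hp u (by omega)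
    rw [ancestor_of_level_eq h.symm rfl (by omega)]
    exact ih _ (by omega) (by omega)

end Forest

namespace IsTreeOfSpaces

variable {X V : Type*} {d : X → X → ℕ} {π : X → V} {ℓ : V → ℕ} {par : V → V}

theorem ancestor_eq_of_adj (h : IsTreeOfSpaces d π ℓ par) {x y : X} {k : ℕ} (hxy : d x y ≤ 1)
    (hx : k ≤ ℓ (π x)) (hy : k ≤ ℓ (π y)) :
    ancestor ℓ par k (π x) = ancestor ℓ par k (π y) := by
  rcases h.adj x y hxy with e | ⟨e, e'⟩ | ⟨e, e'⟩
  · rw [e]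
  · exact ancestor_of_level_eq e e' hy
  · exact (ancestor_of_level_eq e e' hx).symm

theorem exit (h : IsTreeOfSpaces d π ℓ par) {x z : X} {k : ℕ} (hxz : d x z ≤ 1)
    (hk : k ≤ ℓ (π x)) (hz : ℓ (π z) < k) :
    π x = ancestor ℓ par k (π x) ∧ ℓ (π x) = k ∧ π z = par (π x) := by
  rcases h.adj x z hxz with e | ⟨e, e'⟩ | ⟨e, e'⟩
  · rw [e] at hk; omega
  · have hk' : ℓ (π x) = k := by omega
    refine ⟨?_, hk', e'.symm⟩
    rw [← hk', ancestor_self]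
  · omega

/-- A path from a point below the vertex `ancestor k (π x)` either stays below this vertex or
passes through its gate. -/
theorem crossing (h : IsTreeOfSpaces d π ℓ par) {k n : ℕ} {x y : X} (hxy : d x y ≤ n)
    (hk : k ≤ ℓ (π x)) :
    (k ≤ ℓ (π y) ∧ ancestor ℓ par k (π y) = ancestor ℓ par k (π x)) ∨
      (0 < k ∧ ∃ e z, π e = ancestor ℓ par k (π x) ∧ ℓ (π e) = k ∧ π z = par (π e) ∧
        d e z ≤ 1 ∧ d x e ≤ n) := by
  induction n generalizing x with
  | zero =>
    obtain rfl := h.eq_of_dist_eq_zero x y (by omega)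
    exact Or.inl ⟨hk, rfl⟩
  | succ n ih =>
    obtain ⟨z, hxz, hzy⟩ := h.geodesic x y n hxy
    by_cases hz : k ≤ ℓ (π z)
    · have e := h.ancestor_eq_of_adj hxz hk hz
      rcases ih hzy hz with h1 | ⟨h0, e', w, h1, h2, h3, h4, h5⟩
      · exact Or.inl ⟨h1.1, h1.2.trans e.symm⟩
      · have := h.metric.triangle x z e'
        exact Or.inr ⟨h0, e', w, h1.trans e.symm, h2, h3, h4, by omega⟩
    · obtain ⟨h1, h2, h3⟩ := h.exit hxz hk (by omega)
      exact Or.inr ⟨by omega, x, z, h1, h2, h3, hxz, by simp [h.metric.self]⟩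

theorem level_le (h : IsTreeOfSpaces d π ℓ par) {n : ℕ} {x y : X} (hxy : d x y ≤ n) :
    ℓ (π x) ≤ ℓ (π y) + n := by
  induction n generalizing x with
  | zero =>
    obtain rfl := h.eq_of_dist_eq_zero x y (by omega)
    omega
  | succ n ih =>
    obtain ⟨z, hxz, hzy⟩ := h.geodesic x y n hxy
    have := ih hzy
    rcases h.adj x z hxz with e | ⟨e, -⟩ | ⟨e, -⟩
    · rw [e]; omega
    · omega
    · omega

/-- Adding a level costs no colors: away from a neighborhood of the earlier levels, distinct vertex
spaces of the new level are more than `r` apart, and the saturated union applies. -/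
theorem uniformlyColorable_below (h : IsTreeOfSpaces d π ℓ par) {k : ℕ}
    (hF : UniformlyColorable d (fun v => π ⁻¹' {v}) k) (m : ℕ) :
    UniformlyColorable d (below π ℓ par m) k := by
  induction m with
  | zero =>
    refine hF.mono (fun v => ⟨v, ?_⟩) le_rfl
    rintro x ⟨h1, h2, h3⟩
    have e : ℓ v = ℓ (π x) := by omega
    rw [e, ancestor_self] at h3
    exact h3
  | succ m ih =>
    classical
    intro r
    obtain ⟨D₁, hD₁⟩ := hF r
    -- A step of length `r` out of a vertex space meets its gate, one further step from the parent;
    -- hence the radius `r + 1`.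
    obtain ⟨D₂, hD₂⟩ := ih.neighborhood h.metric (r + 1) (D₁ + 2 * r)
    choose cF hcF hcF' using hD₁
    choose cN hcN hcN' using hD₂
    refine ⟨2 * (D₁ + D₂ + r), fun v => ?_⟩
    set N := neighborhood d (below π ℓ par m v) (r + 1) with hN
    refine ⟨fun x => if x ∈ N then cN v x else cF (π x) x, fun x => ?_, ?_⟩
    · dsimp only
      split_ifs
      exacts [hcN v x, hcF _ x]
    have hP : IsColoring d (below π ℓ par (m + 1) v \ N)
        (fun x => if x ∈ N then cN v x else cF (π x) x) r D₁ := by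
      refine .of_fibers π ?_ fun u => (hcF' u).congr (fun x hx => hx.2) fun x hx => ?_
      · have hlev : ∀ a ∈ below π ℓ par (m + 1) v \ N, ℓ (π a) = ℓ v + m + 1 := by
          rintro a ⟨⟨h1, h2, h3⟩, h4⟩
          by_contra hne
          exact h4 ⟨a, ⟨h1, by omega, h3⟩, by simp [h.metric.self]⟩
        rintro a b ⟨ha, hb, -, hab⟩
        have la := hlev a ha
        have lb := hlev b hb
        rcases h.crossing hab le_rfl with ⟨-, e⟩ | ⟨-, e, z, h1, h2, h3, h4, h5⟩
        · rw [ancestor_self, la, ← lb, ancestor_self] at e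
          exact e.symm
        · rw [ancestor_self] at h1
          have h6 := h.level_par (π a) (by omega)
          rw [h1] at h3
          refine absurd ⟨z, ⟨?_, ?_, ?_⟩, ?_⟩ ha.2
          · rw [h3]; omega
          · rw [h3]; omega
          · rw [h3]
            exact (ancestor_of_level_eq h6.symm rfl (by omega)).symm.trans ha.1.2.2
          · have := h.metric.triangle a e z
            omega
      · rw [if_neg hx.1.2, hx.2]
    refine (IsColoring.union h.metric hP ((hcN' v).congr (c' := fun x => if x ∈ N then cN v x
      else cF (π x) x) subset_rfl fun x hx => if_pos hx)).congr (fun x hx => ?_) fun x _ => rfl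
    by_cases hxN : x ∈ N
    exacts [Or.inr hxN, Or.inl ⟨hx, hxN⟩]

theorem depth_le_add (h : IsTreeOfSpaces d π ℓ par) (v : V) (x y : X) :
    depth d π par v x ≤ depth d π par v y + d x y := by
  unfold depth
  -- For an empty gate both depths are the default value `0`.
  rcases Set.eq_empty_or_nonempty {n | ∃ e ∈ gate d π par v, d y e ≤ n} with he | he
  · have : {n | ∃ e ∈ gate d π par v, d x e ≤ n} = ∅ := by
      refine Set.eq_empty_of_forall_notMem ?_
      rintro n ⟨e, h1, h2⟩
      exact he.subset ⟨e, h1, le_rfl⟩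
    rw [this]
    simp
  · obtain ⟨e, h1, h2⟩ := Nat.sInf_mem he
    refine Nat.sInf_le ⟨e, h1, (h.metric.triangle x y e).trans ?_⟩
    omega

theorem exists_dist_eq_depth (h : IsTreeOfSpaces d π ℓ par) (v : V) (hv : 0 < ℓ v) (x : X) :
    ∃ e ∈ gate d π par v, d x e ≤ depth d π par v x := by
  obtain ⟨e, z, h1, h2, h3⟩ := h.exists_gate v hv
  exact Nat.sInf_mem (s := {n | ∃ e ∈ gate d π par v, d x e ≤ n})
    ⟨_, e, ⟨h1, z, h2, h3⟩, le_rfl⟩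

theorem level_le_add_depth (h : IsTreeOfSpaces d π ℓ par) (v : V) (hv : 0 < ℓ v) (x : X) :
    ℓ (π x) ≤ ℓ v + depth d π par v x := by
  obtain ⟨e, ⟨h1, -⟩, h2⟩ := h.exists_dist_eq_depth v hv x
  have := h.level_le h2
  rwa [h1] at this

theorem below_or_depth_le (h : IsTreeOfSpaces d π ℓ par) {k n : ℕ} {x y : X} (hxy : d x y ≤ n)
    (hk : k ≤ ℓ (π x)) :
    (k ≤ ℓ (π y) ∧ ancestor ℓ par k (π y) = ancestor ℓ par k (π x)) ∨
      (0 < k ∧ depth d π par (ancestor ℓ par k (π x)) x ≤ n) := by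
  rcases h.crossing hxy hk with h1 | ⟨h0, e, z, h1, h2, h3, h4, h5⟩
  · exact Or.inl h1
  · exact Or.inr ⟨h0, Nat.sInf_le ⟨e, ⟨h1, z, by rw [h3, h1], h4⟩, h5⟩⟩

end IsTreeOfSpaces

/-! ### The combination theorem. -/

/-- The combination theorem: if the vertex spaces are uniformly colorable with `n + 1` colors and
the gates with `n` colors, then the total space is colorable with `n + 1` colors. -/
theorem IsTreeOfSpaces.exists_coloring {X V : Type*} {d : X → X → ℕ} {π : X → V} {ℓ : V → ℕ}
    {par : V → V} (h : IsTreeOfSpaces d π ℓ par) {n : ℕ}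
    (hF : UniformlyColorable d (fun v => π ⁻¹' {v}) (n + 1))
    (hE : UniformlyColorable d (fun v => {e ∈ gate d π par v | 0 < ℓ v}) n) (r : ℕ) :
    ∃ D : ℕ, ∃ c : X → ℕ, (∀ x, c x < n + 1) ∧ IsColoring d Set.univ c r D := by
  classical
  -- Here `s` exceeds every step, `L` allows `n + 1` layers of thickness `s` beyond an initial
  -- collar of width `s`, and `M` keeps a shell and its `r`-neighbors above the next cut level.
  obtain ⟨s, hs⟩ : ∃ s, s = r + 1 := ⟨_, rfl⟩
  obtain ⟨L, hL⟩ : ∃ L, L = (n + 2) * s := ⟨_, rfl⟩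
  obtain ⟨M, hM⟩ : ∃ M, M = L + s := ⟨_, rfl⟩
  have hsL : s + s ≤ L := by rw [hL]; nlinarith
  set a : X → ℕ → V := fun x k => ancestor ℓ par (M * k) (π x) with ha
  set dep : V → X → ℕ := depth d π par with hdep
  have hcomm := h.metric.comm
  have hMs : ∀ k, M * (k + 1) = M * k + M := fun k => by ring
  have hdepth : ∀ v x y, d x y ≤ r → dep v x ≤ dep v y + r := fun v x y hxy =>
    (h.depth_le_add v x y).trans (Nat.add_le_add_left hxy _)
  have hlevel : ∀ x y, d x y ≤ r → ℓ (π x) ≤ ℓ (π y) + r := fun x y hxy => h.level_le hxy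
  have hla : ∀ x k, M * k ≤ ℓ (π x) → ℓ (a x k) = M * k := fun x k hk =>
    level_ancestor h.level_par _ _ hk
  have hld : ∀ x k, 1 ≤ k → M * k ≤ ℓ (π x) → ℓ (π x) ≤ M * k + dep (a x k) x := by
    intro x k hk hx
    have h1 := hla x k hx
    have h2 : 0 < M * k := Nat.mul_pos (by omega) hk
    have := h.level_le_add_depth (a x k) (by omega) x
    rwa [h1] at this
  -- `deep x k` holds when `x` is below the shell around the gate of its ancestor at level `M k`.
  set deep : X → ℕ → Prop := fun x k => k = 0 ∨ (M * k ≤ ℓ (π x) ∧ s ≤ dep (a x k) x)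
    with hdeep
  have deep_le : ∀ x k, deep x k → M * k ≤ ℓ (π x) := by
    rintro x k (rfl | hk)
    exacts [by simp, hk.1]
  -- Leaving the subtree means passing through the gate, at distance at least `s > r`.
  have deep_near : ∀ x y k, deep x k → d x y ≤ r → M * k ≤ ℓ (π y) ∧ a y k = a x k := by
    intro x y k hk hxy
    rcases h.below_or_depth_le hxy (deep_le x k hk) with h1 | ⟨h0, h1⟩
    · exact h1
    · rcases hk with rfl | ⟨-, hk⟩
      · omega
      · have : dep (a x k) x ≤ r := h1
        omega
  have deep_of_level : ∀ x k, M * k + M ≤ ℓ (π x) → deep x k := by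
    intro x k hx
    rcases Nat.eq_zero_or_pos k with hk | hk
    · exact Or.inl hk
    · have := hld x k hk (by omega)
      exact Or.inr ⟨by omega, by omega⟩
  have hκ : ∀ x, ∃ k, deep x k ∧ ∀ j, deep x j → j ≤ k := by
    intro x
    refine ⟨Nat.findGreatest (deep x) (ℓ (π x)),
      Nat.findGreatest_spec (Nat.zero_le _) (Or.inl rfl), fun j hj =>
      Nat.le_findGreatest ?_ hj⟩
    calc j ≤ M * j := Nat.le_mul_of_pos_left j (by omega)
      _ ≤ _ := deep_le x j hj
  choose κ hκd hκm using hκ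
  have κ_le : ∀ x k, ℓ (π x) < M * k + M → κ x ≤ k := by
    intro x k hx
    by_contra! hlt
    have h1 := deep_le x _ (hκd x)
    have h2 : M * (k + 1) ≤ M * κ x := Nat.mul_le_mul_left M hlt
    rw [hMs] at h2
    omega
  -- The cut vertex `v x` names the region of `x`; `P` is the union of the shells.
  set v : X → V := fun x => a x (κ x) with hv
  set P : Set X := {x | 1 ≤ κ x ∧ dep (v x) x < L} with hPdef
  have near_shell : ∀ x ∈ P, ∀ y, d x y ≤ r → M * κ x ≤ ℓ (π y) ∧ a y (κ x) = v x ∧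
      κ y ≤ κ x ∧ s ≤ dep (v x) x := by
    rintro x ⟨hx1, hx2⟩ y hxy
    obtain ⟨h1, h2⟩ := deep_near x y _ (hκd x) hxy
    refine ⟨h1, h2, κ_le y _ ?_, ?_⟩
    · have := hld x (κ x) hx1 (deep_le x _ (hκd x))
      have := hlevel y x (hcomm x y ▸ hxy)
      have : dep (a x (κ x)) x < L := hx2
      omega
    · rcases hκd x with h0 | h0
      · omega
      · exact h0.2
  have shell_shell : ∀ x ∈ P, ∀ y ∈ P, d x y ≤ r → κ x = κ y ∧ v x = v y := by
    intro x hx y hy hxy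
    obtain ⟨-, h2, h3, -⟩ := near_shell x hx y hxy
    obtain ⟨-, -, h3', -⟩ := near_shell y hy x (hcomm x y ▸ hxy)
    have e : κ x = κ y := le_antisymm h3' h3
    exact ⟨e, by rw [← h2, e]⟩
  -- Away from its far end a shell can only border the region above it; away from its gate end
  -- (`outer`) it borders only the region of its own vertex.
  have inner : ∀ x ∈ P, ∀ y ∉ P, d x y ≤ r → dep (v x) x + r < L → v y = a x (κ x - 1) := by
    intro x hx y hy hxy hlt
    obtain ⟨h1, h2, h3, -⟩ := near_shell x hx y hxy
    have hx1 : 1 ≤ κ x := hx.1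
    have hM' : M * κ x = M * (κ x - 1) + M := by rw [← hMs, Nat.sub_add_cancel hx1]
    have hne : κ y ≠ κ x := by
      intro e
      have e' : v y = v x := by rw [← h2, ← e]
      refine hy ⟨by omega, ?_⟩
      rw [e']
      have := hdepth (v x) y x (hcomm x y ▸ hxy)
      omega
    have hky : κ x - 1 ≤ κ y := hκm y _ (deep_of_level y _ (by omega))
    have e : κ y = κ x - 1 := by omega
    have hxd : deep x (κ x - 1) := deep_of_level x _ (by have := deep_le x _ (hκd x); omega)
    rw [← (deep_near x y _ hxd hxy).2, ← e]
  have outer : ∀ x ∈ P, ∀ y, d x y ≤ r → s + r ≤ dep (v x) x → v y = v x := by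
    intro x hx y hxy hle
    obtain ⟨h1, h2, h3, -⟩ := near_shell x hx y hxy
    have hyd : deep y (κ x) := Or.inr ⟨h1, by
      have := hdepth (v x) x y hxy
      rw [h2]; omega⟩
    rw [← h2, le_antisymm (hκm y _ hyd) h3]
  have compl_compl : ∀ x ∉ P, ∀ y ∉ P, d x y ≤ r → v x = v y := by
    have main : ∀ x, ∀ y ∉ P, d x y ≤ r → κ x ≤ κ y → v x = v y := by
      intro x y hy hxy hle
      obtain ⟨h1, h2⟩ := deep_near y x _ (hκd y) (hcomm x y ▸ hxy)
      rcases Nat.eq_zero_or_pos (κ y) with h0 | h0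
      · have e : κ x = κ y := by omega
        rw [hv]; dsimp only; rw [e, h2]
      · have hyL : L ≤ dep (v y) y := by
          by_contra! hlt
          exact hy ⟨h0, hlt⟩
        have hxd : deep x (κ y) := Or.inr ⟨h1, by
          have := hdepth (v y) y x (hcomm x y ▸ hxy)
          rw [h2]
          have : dep (a y (κ y)) y ≤ dep (a y (κ y)) x + r := this
          have : L ≤ dep (a y (κ y)) y := hyL
          omega⟩
        have e : κ x = κ y := le_antisymm hle (hκm x _ hxd)
        rw [hv]; dsimp only; rw [e, h2]
    intro x hx y hy hxy
    rcases le_total (κ x) (κ y) with hle | hle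
    · exact main x y hy hxy hle
    · exact (main y x hx (hcomm x y ▸ hxy) hle).symm
  -- the colorings of the shells and of the regions between them
  obtain ⟨D₁, hD₁⟩ := hE.neighborhood h.metric L r
  obtain ⟨D₂, hD₂⟩ := h.uniformlyColorable_below hF (2 * M) (D₁ + 2 * r)
  choose cg hcg hcg' using hD₁
  choose cb hcb hcb' using hD₂
  set layer : X → ℕ := fun x => (dep (v x) x - s) / s with hlayer
  -- The `n` gate colors are shifted past `layer x`, so that this color is absent from that layer.
  set c : X → ℕ := fun x => if x ∈ P then
    (if cg (v x) x < layer x then cg (v x) x else cg (v x) x + 1) else cb (v x) x with hc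
  have hcP : ∀ x ∈ P, c x = if cg (v x) x < layer x then cg (v x) x else cg (v x) x + 1 :=
    fun x hx => if_pos hx
  have hcQ : ∀ x ∉ P, c x = cb (v x) x := fun x hx => if_neg hx
  have hclt : ∀ x, c x < n + 1 := by
    intro x
    by_cases hx : x ∈ P
    · rw [hcP x hx]
      have := hcg (v x) x
      split_ifs <;> omega
    · rw [hcQ x hx]
      exact hcb _ _
  have layer_bounds : ∀ x ∈ P, s + layer x * s ≤ dep (v x) x ∧
      dep (v x) x < s + (layer x + 1) * s := by
    intro x hx
    have h1 := (near_shell x hx x (by simp [h.metric.self])).2.2.2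
    have h2 := Nat.div_mul_le_self (dep (v x) x - s) s
    have h3 := Nat.lt_mul_of_div_lt (Nat.lt_succ_self ((dep (v x) x - s) / s)) (show 0 < s by omega)
    change dep (v x) x - s < (layer x + 1) * s at h3
    refine ⟨?_, by omega⟩
    show s + (dep (v x) x - s) / s * s ≤ _
    omega
  have layer_ne : ∀ x ∈ P, layer x ≠ c x := by
    intro x hx
    rw [hcP x hx]
    split_ifs <;> omega
  -- Changing sides would jump over the layer omitting the color, which has thickness `s > r`.
  have side : ∀ x ∈ P, ∀ y ∈ P, d x y ≤ r → c x = c y → (c x < layer x ↔ c y < layer y) := by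
    have main : ∀ x ∈ P, ∀ y ∈ P, d x y ≤ r → c x = c y → c x < layer x → c y < layer y := by
      intro x hx y hy hxy hcol hlt
      by_contra hge
      have h1 := (layer_bounds x hx).1
      have h2 := (layer_bounds y hy).2
      have h3 := layer_ne y hy
      have h4 := hdepth (v x) x y hxy
      rw [← (shell_shell x hx y hy hxy).2] at h2
      have h5 : (layer y + 1 + 1) * s ≤ layer x * s := Nat.mul_le_mul_right s (by omega)
      rw [add_mul _ 1 s] at h5
      omega
    exact fun x hx y hy hxy hcol => ⟨main x hx y hy hxy hcol,
      main y hy x hx (hcomm x y ▸ hxy) hcol.symm⟩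
  -- Each shell point is assigned to the region on its side of the layer omitting its color.
  set lab : X → V := fun x => if x ∈ P then (if c x < layer x then v x else a x (κ x - 1))
    else v x with hlab
  have labP : ∀ x ∈ P, lab x = if c x < layer x then v x else a x (κ x - 1) :=
    fun x hx => if_pos hx
  have labQ : ∀ x ∉ P, lab x = v x := fun x hx => if_neg hx
  have lab_PQ : ∀ x ∈ P, ∀ y ∉ P, d x y ≤ r → lab x = lab y := by
    intro x hx y hy hxy
    rw [labP x hx, labQ y hy]
    obtain ⟨h1, h2⟩ := layer_bounds x hx
    split_ifs with hlt
    · have : 1 * s ≤ layer x * s := Nat.mul_le_mul_right s (by omega)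
      exact (outer x hx y hxy (by omega)).symm
    · refine (inner x hx y hy hxy ?_).symm
      have h3 := layer_ne x hx
      have h4 := hclt x
      have : (layer x + 1) * s ≤ n * s := Nat.mul_le_mul_right s (by omega)
      have : L = n * s + 2 * s := by rw [hL]; ring
      omega
  have lab_step : ∀ x y, MonoStep d Set.univ c r x y → lab x = lab y := by
    rintro x y ⟨-, -, hcol, hxy⟩
    by_cases hx : x ∈ P <;> by_cases hy : y ∈ P
    · rw [labP x hx, labP y hy]
      obtain ⟨e1, e2⟩ := shell_shell x hx y hy hxy
      have e3 : a x (κ x - 1) = a y (κ y - 1) := by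
        have hM' : M * κ x = M * (κ x - 1) + M := by rw [← hMs, Nat.sub_add_cancel hx.1]
        have hxd : deep x (κ x - 1) :=
          deep_of_level x _ (by have := deep_le x _ (hκd x); omega)
        rw [← (deep_near x y _ hxd hxy).2, e1]
      rw [e2, e3]
      exact if_congr (side x hx y hy hxy hcol) rfl rfl
    · exact lab_PQ x hx y hy hxy
    · exact (lab_PQ y hy x hx (hcomm x y ▸ hxy)).symm
    · rw [labQ x hx, labQ y hy]
      exact compl_compl x hx y hy hxy
  have colP : IsColoring d P c r D₁ := by
    -- On a fixed side the shift is constant, so equal values of `c` come from equal values of `cg`.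
    refine .of_fibers (fun x => (v x, decide (c x < layer x))) ?_ ?_
    · rintro x y ⟨hx, hy, hcol, hxy⟩
      have := side x hx y hy hxy hcol
      simp only [(shell_shell x hx y hy hxy).2, this]
    · rintro ⟨w, b⟩
      refine (hcg' w).recolor ?_ ?_
      · rintro x ⟨hx, hxw⟩
        obtain rfl : v x = w := congrArg Prod.fst hxw
        have h1 : 0 < M * κ x := Nat.mul_pos (by omega) hx.1
        have h2 := hla x (κ x) (deep_le x _ (hκd x))
        have h3 : 0 < ℓ (v x) := by rw [hv]; dsimp only; rw [h2]; exact h1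
        obtain ⟨e, he, h4⟩ := h.exists_dist_eq_depth (v x) h3 x
        exact ⟨e, ⟨he, h3⟩, h4.trans hx.2.le⟩
      · rintro x ⟨hx, hxw⟩ y ⟨hy, hyw⟩ hcol
        have e1 : v x = w := congrArg Prod.fst hxw
        have e2 : v y = w := congrArg Prod.fst hyw
        have e3 : decide (c x < layer x) = decide (c y < layer y) :=
          (congrArg Prod.snd hxw).trans (congrArg Prod.snd hyw).symm
        rw [decide_eq_decide] at e3
        rw [hcP x hx, hcP y hy, e1, e2] at hcol e3
        split_ifs at hcol e3 <;> omega
  refine ⟨2 * (D₁ + D₂ + r), c, hclt, .of_fibers lab lab_step fun l => ?_⟩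
  have hP' : IsColoring d {x ∈ P | lab x = l} c r D₁ :=
    colP.congr (fun x hx => hx.1) fun _ _ => rfl
  have hQ' : IsColoring d {x | x ∉ P ∧ lab x = l} c (D₁ + 2 * r) D₂ := by
    refine (hcb' l).congr ?_ ?_
    · rintro x ⟨hx, rfl⟩
      rw [labQ x hx]
      have h1 := deep_le x _ (hκd x)
      have h2 := hla x _ h1
      refine ⟨h2.le.trans h1, ?_, ?_⟩
      · show ℓ (π x) ≤ ℓ (a x (κ x)) + 2 * M
        rw [h2]
        -- Two full periods below its cut vertex, `x` would already be deep at `κ x + 1`.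
        by_contra! hlt
        have := hκm x (κ x + 1) (deep_of_level x _ (by rw [hMs]; omega))
        omega
      · show ancestor ℓ par (ℓ (a x (κ x))) (π x) = _
        rw [h2]
    · rintro x ⟨hx, rfl⟩
      rw [hcQ x hx, labQ x hx]
  refine (hP'.union h.metric hQ').congr ?_ fun _ _ => rfl
  rintro x ⟨-, hx⟩
  by_cases hxP : x ∈ P
  exacts [Or.inl ⟨hxP, hx⟩, Or.inr ⟨hxP, hx⟩]

/-- The word metric as a function with natural values. -/
noncomputable def wordDist {G : Type*} [Group G] (S : Set G) (g h : G) : ℕ :=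
  wordLength S (g⁻¹ * h)

theorem UniformlyColorable.of_or {X ι κ : Type*} {d : X → X → ℕ} {F₁ F₂ : ι → Set X}
    {F : κ → Set X} {k : ℕ} (h₁ : UniformlyColorable d F₁ k) (h₂ : UniformlyColorable d F₂ k)
    (hF : ∀ j, ∃ i, F j ⊆ F₁ i ∨ F j ⊆ F₂ i) : UniformlyColorable d F k := by
  intro r
  obtain ⟨D₁, hD₁⟩ := h₁ r
  obtain ⟨D₂, hD₂⟩ := h₂ r
  refine ⟨max D₁ D₂, fun j => ?_⟩
  obtain ⟨i, hi | hi⟩ := hF j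
  · obtain ⟨c, hc, hc'⟩ := hD₁ i
    exact ⟨c, hc, (hc'.congr hi fun _ _ => rfl).mono_bound (le_max_left _ _)⟩
  · obtain ⟨c, hc, hc'⟩ := hD₂ i
    exact ⟨c, hc, (hc'.congr hi fun _ _ => rfl).mono_bound (le_max_right _ _)⟩

theorem exists_asdim_eq {X : Type*} [PseudoMetricSpace X] (h : asdim X ≠ ⊤) :
    ∃ n : ℕ, asdim X = n ∧ AsdimLE X n := by
  classical
  have hex : ∃ n, AsdimLE X n := by
    by_contra! hne
    exact h (by simp [asdim, hne])
  refine ⟨Nat.find hex, le_antisymm (iInf₂_le _ (Nat.find_spec hex)) ?_, Nat.find_spec hex⟩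
  exact le_iInf₂ fun n hn => by exact_mod_cast Nat.find_min' hex hn

/-! ### Word metrics and cosets of subgroups. -/

section WordMetric

variable {G H : Type*} [Group G] [Group H] {S : Set G} {T : Set H}

theorem isNatMetric_wordDist (hS : Subgroup.closure S = ⊤) : IsNatMetric (wordDist S) :=
  @isNatMetric_of_dist G (wordMetric S hS).toPseudoMetricSpace (wordDist S) fun _ _ => rfl

theorem exists_coloring_of_groupAsdim (hS : Subgroup.closure S = ⊤) (h : groupAsdim S hS ≠ ⊤) :
    ∃ n : ℕ, groupAsdim S hS = n ∧
      UniformlyColorable (wordDist S) (fun _ : Unit => Set.univ) (n + 1) := by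
  let := wordMetric S hS
  obtain ⟨n, hn, hn'⟩ := exists_asdim_eq h
  refine ⟨n, hn, fun r => ?_⟩
  obtain ⟨D, hD⟩ := exists_coloring_of_asdimLE (d := wordDist S) (fun _ _ => rfl) hn' r
  exact ⟨D, fun _ => hD⟩

theorem groupAsdim_le (hS : Subgroup.closure S = ⊤) {n : ℕ}
    (h : UniformlyColorable (wordDist S) (fun _ : Unit => Set.univ) (n + 1)) :
    groupAsdim S hS ≤ n := by
  let := wordMetric S hS
  refine iInf₂_le n (asdimLE_of_coloring (d := wordDist S) (fun _ _ => rfl) fun r => ?_)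
  obtain ⟨D, hD⟩ := h r
  exact ⟨D, hD ()⟩

theorem wordLength_le_one {x : G} (hx : x ∈ S ∨ x⁻¹ ∈ S) : wordLength S x ≤ 1 := by
  have hw : IsWord S [x] := by simpa [IsWord] using hx
  simpa using wordLength_prod_le hw

theorem exists_of_wordLength_le_succ (hS : Subgroup.closure S = ⊤) {g : G} {n : ℕ}
    (hg : wordLength S g ≤ n + 1) :
    ∃ x, (x = 1 ∨ x ∈ S ∨ x⁻¹ ∈ S) ∧ wordLength S (x⁻¹ * g) ≤ n := by
  obtain ⟨l, hl, rfl, hn⟩ := exists_isWord_length hS g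
  cases l with
  | nil => exact ⟨1, Or.inl rfl, by simp [wordLength_one]⟩
  | cons x l =>
    refine ⟨x, Or.inr (hl x (by simp)), ?_⟩
    rw [List.prod_cons, inv_mul_cancel_left]
    refine (wordLength_prod_le fun y hy => hl y (by simp [hy])).trans ?_
    rw [List.length_cons] at hn
    omega

theorem eq_one_or_mem_of_wordLength_le_one (hS : Subgroup.closure S = ⊤) {g : G}
    (hg : wordLength S g ≤ 1) : g = 1 ∨ g ∈ S ∨ g⁻¹ ∈ S := by
  obtain ⟨x, hx, h⟩ := exists_of_wordLength_le_succ hS (n := 0) hg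
  rw [← inv_mul_eq_one.1 (eq_one_of_wordLength_eq_zero hS (Nat.le_zero.1 h))]
  exact hx

theorem wordDist_geodesic (hS : Subgroup.closure S = ⊤) (g h : G) (n : ℕ)
    (hgh : wordDist S g h ≤ n + 1) : ∃ z, wordDist S g z ≤ 1 ∧ wordDist S z h ≤ n := by
  obtain ⟨x, hx, hn⟩ := exists_of_wordLength_le_succ hS hgh
  refine ⟨g * x, ?_, ?_⟩
  · rw [wordDist, inv_mul_cancel_left]
    rcases hx with rfl | hx
    · simp [wordLength_one]
    · exact wordLength_le_one hx
  · rwa [wordDist, mul_inv_rev, mul_assoc]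

theorem finite_wordLength_le (hS : Subgroup.closure S = ⊤) (hfin : S.Finite) (n : ℕ) :
    {g | wordLength S g ≤ n}.Finite := by
  induction n with
  | zero =>
    refine (Set.finite_singleton 1).subset fun g hg => ?_
    exact eq_one_of_wordLength_eq_zero hS (Nat.le_zero.1 hg)
  | succ n ih =>
    refine (((((Set.finite_singleton 1).union (hfin.union hfin.inv))).image2 (· * ·) ih)).subset
      fun g hg => ?_
    obtain ⟨x, hx, h⟩ := exists_of_wordLength_le_succ hS hg
    exact ⟨x, hx, x⁻¹ * g, h, by simp⟩

theorem exists_forall_wordLength_le {A : Set G} (hA : A.Finite) :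
    ∃ R, ∀ g ∈ A, wordLength S g ≤ R :=
  (hA.image (wordLength S)).bddAbove.imp fun _ hR g hg => hR ⟨g, hg, rfl⟩

/-- The cosets of a finitely generated subgroup are uniformly as colorable as the subgroup. -/
theorem uniformlyColorable_cosets (hS : Subgroup.closure S = ⊤) (hSfin : S.Finite)
    (hT : Subgroup.closure T = ⊤) (hTfin : T.Finite) (f : H →* G) (hf : Function.Injective f)
    {k : ℕ} (h : UniformlyColorable (wordDist T) (fun _ : Unit => Set.univ) k) :
    UniformlyColorable (wordDist S) (fun g : G => {x | ∃ y, x = g * f y}) k := by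
  have hp : ∀ g x, ∃ y, x ∈ {x | ∃ y, x = g * f y} → x = g * f y := by
    intro g x
    by_cases hx : x ∈ {x | ∃ y, x = g * f y}
    · exact hx.imp fun y hy _ => hy
    · exact ⟨1, fun h => absurd h hx⟩
  choose p hp using hp
  have key : ∀ g, ∀ a ∈ {x | ∃ y, x = g * f y}, ∀ b ∈ {x | ∃ y, x = g * f y},
      a⁻¹ * b = f ((p g a)⁻¹ * p g b) := by
    intro g a ha b hb
    conv_lhs => rw [hp g a ha, hp g b hb]
    simp [mul_assoc]
  -- Both control functions come from finiteness of balls; they are uniform over cosets because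
  -- distances depend only on `a⁻¹ * b`.
  refine h.pullback (isNatMetric_wordDist hS) p (fun _ => ⟨(), fun _ _ => trivial⟩)
    (fun r => ?_) (fun D => ?_)
  · obtain ⟨R, hR⟩ := exists_forall_wordLength_le (S := T)
      ((finite_wordLength_le hS hSfin r).preimage hf.injOn)
    refine ⟨R, fun g a ha b hb hab => hR _ ?_⟩
    rw [wordDist, key g a ha b hb] at hab
    exact hab
  · obtain ⟨R, hR⟩ := exists_forall_wordLength_le (S := S)
      ((finite_wordLength_le hT hTfin D).image f)
    refine ⟨R, fun g a ha b hb hab => ?_⟩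
    rw [wordDist, key g a ha b hb]
    exact hR _ ⟨_, hab, rfl⟩

end WordMetric

end AsymptoticDimension

/-! ### The Bass–Serre tree via reduced words. -/

namespace HNNExtension

open NormalWord

variable {G : Type*} [Group G] {A B : Subgroup G} {φ : A ≃* B}

theorem exists_reducedWord (g : HNNExtension G A B φ) :
    ∃ w : ReducedWord G A B, w.prod φ = g := by
  obtain ⟨d⟩ := TransversalPair.nonempty G A B
  exact ⟨((NormalWord.equiv φ d) g).toReducedWord, (NormalWord.equiv φ d).symm_apply_apply g⟩

theorem conj_mem_range {u : ℤˣ} {k : G} (hk : k ∈ toSubgroup A B (-u)) :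
    ∃ k' : G, (t ^ (u : ℤ))⁻¹ * (of k : HNNExtension G A B φ) * t ^ (u : ℤ) = of k' := by
  rcases Int.units_eq_one_or u with rfl | rfl
  · exact ⟨φ.symm ⟨k, hk⟩, by simp [equiv_symm_eq_conj]⟩
  · rw [neg_neg] at hk
    exact ⟨φ ⟨k, hk⟩, by simp [equiv_eq_conj]⟩

/-- The product of the syllables `t ^ u * a` of a list. -/
def syllables (φ : A ≃* B) (l : List (ℤˣ × G)) : HNNExtension G A B φ :=
  (l.map fun x => t ^ (x.1 : ℤ) * of x.2).prod

theorem syllables_cons (u : ℤˣ) (a : G) (l : List (ℤˣ × G)) :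
    syllables φ ((u, a) :: l) = t ^ (u : ℤ) * (of a * syllables φ l) := by
  simp [syllables, mul_assoc]

theorem prod_eq_of_mul_syllables (w : ReducedWord G A B) :
    w.prod φ = of w.head * syllables φ w.toList := rfl

/-- Left multiplication of a reduced word by an element of the base group. -/
def mulHead (a : G) (w : ReducedWord G A B) : ReducedWord G A B :=
  { w with head := a * w.head }

theorem prod_mulHead (a : G) (w : ReducedWord G A B) :
    (mulHead a w).prod φ = of a * w.prod φ := by
  simp [prod_eq_of_mul_syllables, mulHead, mul_assoc]

/-- A reduced word for `g⁻¹`. -/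
noncomputable def invWord (g : HNNExtension G A B φ) : ReducedWord G A B :=
  (exists_reducedWord g⁻¹).choose

theorem prod_invWord (g : HNNExtension G A B φ) : (invWord g).prod φ = g⁻¹ :=
  (exists_reducedWord g⁻¹).choose_spec

/-- The vertices of the Bass–Serre tree: the left cosets of the base group. -/
abbrev Vertex (φ : A ≃* B) : Type _ :=
  HNNExtension G A B φ ⧸ (of : G →* HNNExtension G A B φ).range

theorem mk_eq_mk_iff {g g' : HNNExtension G A B φ} :
    (QuotientGroup.mk g : Vertex φ) = QuotientGroup.mk g' ↔ ∃ a : G, g' = g * of a := by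
  rw [QuotientGroup.eq]
  constructor
  · rintro ⟨a, ha⟩
    exact ⟨a, by rw [ha, mul_inv_cancel_left]⟩
  · rintro ⟨a, rfl⟩
    exact ⟨a, by simp⟩

/-- The distance from the vertex `v` to the base vertex of the Bass–Serre tree. -/
noncomputable def level (v : Vertex φ) : ℕ := (invWord v.out).toList.length

/-- The neighbour of the vertex `v` that is closest to the base vertex. -/
noncomputable def parent (v : Vertex φ) : Vertex φ :=
  match (invWord v.out).toList with
  | [] => v
  | (_, a) :: l => QuotientGroup.mk (of a * syllables φ l)⁻¹

theorem exists_out_eq (g : HNNExtension G A B φ) :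
    ∃ a : G, (QuotientGroup.mk g : Vertex φ).out = g * of a :=
  mk_eq_mk_iff.1 (Quotient.out_eq' (QuotientGroup.mk g : Vertex φ)).symm

/-- Another representative of the left coset changes `g⁻¹` by a left factor from the base group,
which only affects the head. This is why `level` and `parent` read words of inverses. -/
theorem prod_eq_invWord_out {g : HNNExtension G A B φ} {w : ReducedWord G A B}
    (hw : w.prod φ = g⁻¹) :
    ∃ a : G, (invWord (QuotientGroup.mk g : Vertex φ).out).prod φ = (mulHead a w).prod φ := by
  obtain ⟨a, ha⟩ := exists_out_eq g
  exact ⟨a⁻¹, by rw [prod_invWord, ha, prod_mulHead, hw]; simp⟩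

/-- By Britton's lemma the exponents of a reduced word depend only on its product, so the level is
independent of all choices. -/
theorem level_mk {g : HNNExtension G A B φ} {w : ReducedWord G A B} (hw : w.prod φ = g⁻¹) :
    level (QuotientGroup.mk g : Vertex φ) = w.toList.length := by
  obtain ⟨a, ha⟩ := prod_eq_invWord_out hw
  rw [level]
  simpa [mulHead] using congrArg List.length (ReducedWord.map_fst_eq_and_of_prod_eq φ ha).1

theorem parent_mk {g : HNNExtension G A B φ} {w : ReducedWord G A B} (hw : w.prod φ = g⁻¹)
    {u : ℤˣ} {b : G} {l : List (ℤˣ × G)} (hl : w.toList = (u, b) :: l) :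
    parent (QuotientGroup.mk g : Vertex φ) = QuotientGroup.mk (of b * syllables φ l)⁻¹ := by
  obtain ⟨a, ha⟩ := prod_eq_invWord_out hw
  obtain ⟨h1, h2⟩ := ReducedWord.map_fst_eq_and_of_prod_eq φ ha
  unfold parent
  generalize invWord (QuotientGroup.mk g : Vertex φ).out = w' at ha h1 h2
  rcases w' with ⟨c, _ | ⟨⟨u', b'⟩, l'⟩, hchain⟩
  · simp [mulHead, hl] at h1
  · have hu : u' = u := by
      simp only [mulHead, hl, List.map_cons, List.cons.injEq] at h1
      exact h1.1
    subst hu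
    -- The heads differ by an element of an associated subgroup; moved past the stable letter, it
    -- stays in the base group, so the tails define the same coset.
    obtain ⟨k, hk⟩ := conj_mem_range (φ := φ) (h2 u' (by simp))
    simp only [prod_eq_of_mul_syllables, hl, mulHead, syllables_cons] at ha hk
    refine mk_eq_mk_iff.2 ⟨k, ?_⟩
    rw [← hk]
    have : of b' * syllables φ l' =
        (t ^ (u' : ℤ))⁻¹ * (of c)⁻¹ * of (a * w.head) * t ^ (u' : ℤ) * (of b * syllables φ l) := by
      have := congrArg (fun x => (t ^ (u' : ℤ))⁻¹ * (of c)⁻¹ * x) ha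
      simpa [mul_assoc] using this
    rw [this]
    simp [mul_assoc]

/-- Right multiplication by `t ^ u` moves a vertex away from the base vertex, unless there is a
cancellation. -/
theorem mk_mul_t_zpow (g : HNNExtension G A B φ) (u : ℤˣ) {w : ReducedWord G A B}
    (hw : w.prod φ = g⁻¹) :
    (level (QuotientGroup.mk (g * t ^ (u : ℤ)) : Vertex φ) =
        level (QuotientGroup.mk g : Vertex φ) + 1 ∧
      parent (QuotientGroup.mk (g * t ^ (u : ℤ)) : Vertex φ) = QuotientGroup.mk g) ∨
    (level (QuotientGroup.mk g : Vertex φ) =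
        level (QuotientGroup.mk (g * t ^ (u : ℤ)) : Vertex φ) + 1 ∧
      parent (QuotientGroup.mk g : Vertex φ) = QuotientGroup.mk (g * t ^ (u : ℤ)) ∧
      w.head ∈ toSubgroup A B (-u) ∧ w.toList.head?.map Prod.fst = some u) := by
  have hinv : (g * t ^ (u : ℤ))⁻¹ = t ^ ((-u : ℤˣ) : ℤ) * g⁻¹ := by simp
  -- Prepending `t ^ (-u)` to the word of `g⁻¹` stays reduced exactly when there is no such pinch.
  by_cases hcan : w.head ∈ toSubgroup A B (-u) ∧ w.toList.head?.map Prod.fst = some u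
  · right
    obtain ⟨hmem, hhead⟩ := hcan
    obtain ⟨k, hk⟩ := conj_mem_range (φ := φ) hmem
    obtain ⟨c, hcl, hchain⟩ := w
    obtain _ | ⟨⟨u', b⟩, l⟩ := hcl
    · simp at hhead
    · obtain rfl : u' = u := by simpa using hhead
      have hg : g⁻¹ = of c * (t ^ (u' : ℤ) * (of b * syllables φ l)) := by
        rw [← hw, prod_eq_of_mul_syllables, syllables_cons]
      have hg' : (g * t ^ (u' : ℤ))⁻¹ = of k * (of b * syllables φ l) := by
        rw [hinv, hg, ← hk]
        simp [mul_assoc]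
      have hw' : (⟨k * b, l, (List.isChain_cons.1 hchain).2⟩ : ReducedWord G A B).prod φ =
          (g * t ^ (u' : ℤ))⁻¹ := by
        rw [hg', prod_eq_of_mul_syllables]
        simp [mul_assoc]
      refine ⟨?_, ?_, hmem, hhead⟩
      · rw [level_mk hw, level_mk hw']
        rfl
      · rw [parent_mk hw rfl, mk_eq_mk_iff]
        exact ⟨k⁻¹, by rw [← inv_inj, hg']; simp⟩
  · left
    have hw' : (⟨1, (-u, w.head) :: w.toList, List.isChain_cons.2 ⟨by
        rintro ⟨u', b⟩ hy hmem
        by_contra hne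
        refine hcan ⟨hmem, ?_⟩
        rw [Option.mem_def] at hy
        rw [hy, Option.map_some, Option.some_inj]
        exact (neg_eq_iff_eq_neg.1 (Int.units_ne_iff_eq_neg.1 hne)).trans (neg_neg u') |>.symm ▸ rfl,
        w.chain⟩⟩ : ReducedWord G A B).prod φ = (g * t ^ (u : ℤ))⁻¹ := by
      rw [hinv, prod_eq_of_mul_syllables, syllables_cons, ← hw, prod_eq_of_mul_syllables]
      simp
    refine ⟨?_, ?_⟩
    · rw [level_mk hw', level_mk hw]
      rfl
    · rw [parent_mk hw' rfl, ← prod_eq_of_mul_syllables, hw, inv_inv]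

theorem closure_eq_top {S : Set G} (hS : Subgroup.closure S = ⊤) :
    Subgroup.closure ((of '' S ∪ {t} : Set (HNNExtension G A B φ))) = ⊤ := by
  rw [eq_top_iff]
  rintro x -
  induction x using HNNExtension.induction_on with
  | of g =>
    have hg : g ∈ Subgroup.closure S := hS ▸ Subgroup.mem_top g
    have : of g ∈ (Subgroup.closure S).map (of : G →* HNNExtension G A B φ) := ⟨g, hg, rfl⟩
    rw [MonoidHom.map_closure] at this
    exact Subgroup.closure_mono Set.subset_union_left this
  | t => exact Subgroup.subset_closure (Or.inr rfl)
  | mul x y hx hy => exact mul_mem hx hy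
  | inv x hx => exact inv_mem hx

open AsymptoticDimension

variable {S : Set G}

/-- Elements at distance one either lie in the same coset of the base group or differ by a power
`t ^ u` with `u = ±1`. -/
theorem eq_mul_of_wordDist_le_one (hS : Subgroup.closure S = ⊤) {x y : HNNExtension G A B φ}
    (hxy : wordDist (of '' S ∪ {t}) x y ≤ 1) :
    (∃ a : G, y = x * of a) ∨ ∃ u : ℤˣ, y = x * t ^ (u : ℤ) := by
  rcases eq_one_or_mem_of_wordLength_le_one (closure_eq_top hS) hxy with
    h | (⟨a, -, h⟩ | h) | (⟨a, -, h⟩ | h)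
  · exact Or.inl ⟨1, by rw [map_one, mul_one, inv_mul_eq_one.1 h]⟩
  · exact Or.inl ⟨a, by rw [h, mul_inv_cancel_left]⟩
  · exact Or.inr ⟨1, by rw [← (show x⁻¹ * y = t from h)]; simp⟩
  · exact Or.inl ⟨a⁻¹, by rw [map_inv, h, inv_inv, mul_inv_cancel_left]⟩
  · refine Or.inr ⟨-1, ?_⟩
    rw [← (show (x⁻¹ * y)⁻¹ = t from h)]
    simp

/-- The Cayley graph of an HNN extension is a tree of spaces over the Bass–Serre tree. -/
theorem isTreeOfSpaces (φ : A ≃* B) (hS : Subgroup.closure S = ⊤) :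
    IsTreeOfSpaces (wordDist (of '' S ∪ {t} : Set (HNNExtension G A B φ)))
      (fun g => (QuotientGroup.mk g : Vertex φ)) level parent where
  metric := isNatMetric_wordDist (closure_eq_top hS)
  eq_of_dist_eq_zero x y h :=
    inv_mul_eq_one.1 (eq_one_of_wordLength_eq_zero (closure_eq_top hS) h)
  geodesic := wordDist_geodesic (closure_eq_top hS)
  adj x y hxy := by
    rcases eq_mul_of_wordDist_le_one hS hxy with ⟨a, rfl⟩ | ⟨u, rfl⟩
    · exact Or.inl (mk_eq_mk_iff.2 ⟨a, rfl⟩)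
    · rcases mk_mul_t_zpow x u (prod_invWord x) with h | h
      · exact Or.inr (Or.inr h)
      · exact Or.inr (Or.inl ⟨h.1, h.2.1⟩)
  exists_gate v hv := by
    induction v using QuotientGroup.induction_on with
    | H g =>
      obtain ⟨⟨c, l, hchain⟩, hw⟩ := exists_reducedWord g⁻¹
      rw [level_mk hw] at hv
      rcases l with _ | ⟨⟨u, b⟩, l⟩
      · simp at hv
      · refine ⟨g * of c, g * of c * t ^ (u : ℤ), (mk_eq_mk_iff.2 ⟨c, rfl⟩).symm, ?_, ?_⟩
        · rw [parent_mk hw rfl]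
          congr 1
          rw [← inv_inj, inv_inv, mul_inv_rev, mul_inv_rev, ← hw, prod_eq_of_mul_syllables,
            syllables_cons]
          simp
        · rw [wordDist, inv_mul_cancel_left]
          refine wordLength_le_one ?_
          rcases Int.units_eq_one_or u with rfl | rfl
          · exact Or.inl (Or.inr (by simp))
          · exact Or.inr (Or.inr (by simp))
  level_par v hv := by
    induction v using QuotientGroup.induction_on with
    | H g =>
      obtain ⟨⟨c, l, hchain⟩, hw⟩ := exists_reducedWord g⁻¹
      rw [level_mk hw] at hv ⊢
      rcases l with _ | ⟨⟨u, b⟩, l⟩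
      · simp at hv
      · have hw' : (⟨b, l, (List.isChain_cons.1 hchain).2⟩ : ReducedWord G A B).prod φ =
            ((of b * syllables φ l)⁻¹)⁻¹ := by
          rw [inv_inv, prod_eq_of_mul_syllables]
        rw [parent_mk hw rfl, level_mk hw']
        rfl

/-- A gate point reaches the parent by one stable letter, which lowers the level and therefore
cancels in `mk_mul_t_zpow`. -/
theorem head_mem_of_mem_gate (hS : Subgroup.closure S = ⊤) {v : Vertex φ} (hv : 0 < level v)
    {e : HNNExtension G A B φ}
    (he : e ∈ gate (wordDist (of '' S ∪ {t})) (fun g => (QuotientGroup.mk g : Vertex φ)) parent v)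
    {w : ReducedWord G A B} (hw : w.prod φ = e⁻¹) :
    ∃ u : ℤˣ, w.head ∈ toSubgroup A B (-u) ∧ w.toList.head?.map Prod.fst = some u := by
  obtain ⟨rfl, z, hz, hez⟩ := he
  have hlev := (isTreeOfSpaces φ hS).level_par _ hv
  rw [← hz] at hlev
  dsimp only at hlev
  rcases eq_mul_of_wordDist_le_one hS hez with ⟨a, rfl⟩ | ⟨u, rfl⟩
  · rw [← mk_eq_mk_iff.2 ⟨a, rfl⟩] at hlev
    omega
  · rcases mk_mul_t_zpow e u hw with h | h
    · omega
    · exact ⟨u, h.2.2⟩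

/-- The gates of the Bass–Serre tree lie in cosets of the associated subgroups. -/
theorem exists_gate_subset (hS : Subgroup.closure S = ⊤) {v : Vertex φ} (hv : 0 < level v) :
    ∃ (g : HNNExtension G A B φ) (u : ℤˣ),
      ∀ e ∈ gate (wordDist (of '' S ∪ {t})) (fun g => (QuotientGroup.mk g : Vertex φ)) parent v,
        ∃ a ∈ toSubgroup A B u, e = g * of a := by
  obtain ⟨g, z, hg, hz, hgz⟩ := (isTreeOfSpaces φ hS).exists_gate v hv
  obtain ⟨w, hw⟩ := exists_reducedWord g⁻¹
  obtain ⟨u, hu, hu'⟩ := head_mem_of_mem_gate hS hv ⟨hg, z, hz, hgz⟩ hw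
  refine ⟨g, -u, fun e he => ?_⟩
  obtain ⟨a, rfl⟩ := mk_eq_mk_iff.1 (hg.trans he.1.symm)
  obtain ⟨u', h1, h2⟩ := head_mem_of_mem_gate hS hv he (w := mulHead a⁻¹ w)
    (by rw [prod_mulHead, hw]; simp)
  -- The words of `g⁻¹` and `e⁻¹` share their exponents, so both heads lie in the same associated
  -- subgroup, and so does their quotient `a⁻¹`.
  obtain rfl : u = u' := Option.some_inj.1 (hu'.symm.trans h2)
  refine ⟨a, ?_, rfl⟩
  have h3 := mul_mem h1 (inv_mem hu)
  simpa [mulHead] using h3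

end HNNExtension

/-! ### The theorem. -/

open AsymptoticDimension in
theorem theoremA1 {A C : Type*} [Group A] [Group C] (hA : Group.FG A) (hC : Group.FG C)
    (i j : C →* A) (hi : Function.Injective i) (hj : Function.Injective j) :
    Group.FG (AsymptoticDimension.HNN i j hi hj) ∧
    ∀ (SA : Set A) (_ : SA.Finite) (hSA : Subgroup.closure SA = ⊤)
      (SC : Set C) (_ : SC.Finite) (hSC : Subgroup.closure SC = ⊤)
      (SG : Set (AsymptoticDimension.HNN i j hi hj)) (_ : SG.Finite)
      (hSG : Subgroup.closure SG = ⊤),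
      AsymptoticDimension.groupAsdim SG hSG ≤
        max (AsymptoticDimension.groupAsdim SA hSA) (AsymptoticDimension.groupAsdim SC hSC + 1) := by
  refine ⟨?_, fun SA hSAf hSA SC hSCf hSC SG hSGf hSG => ?_⟩
  · obtain ⟨S, hS, hSf⟩ := Group.fg_iff.1 hA
    exact Group.fg_iff.2 ⟨_, HNNExtension.closure_eq_top hS,
      (hSf.image _).union (Set.finite_singleton _)⟩
  by_cases hAtop : groupAsdim SA hSA = ⊤
  · simp [hAtop]
  by_cases hCtop : groupAsdim SC hSC = ⊤
  · simp [hCtop]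
  obtain ⟨n, hn, hAn⟩ := exists_coloring_of_groupAsdim hSA hAtop
  obtain ⟨m, hm, hCm⟩ := exists_coloring_of_groupAsdim hSC hCtop
  rw [hn, hm]
  set φ := (MonoidHom.ofInjective hi).symm.trans (MonoidHom.ofInjective hj)
  set S : Set (HNN i j hi hj) := HNNExtension.of '' SA ∪ {HNNExtension.t}
  have hS : Subgroup.closure S = ⊤ := HNNExtension.closure_eq_top hSA
  have hSf : S.Finite := (hSAf.image _).union (Set.finite_singleton _)
  have hof : Function.Injective (HNNExtension.of : A →* HNN i j hi hj) :=
    HNNExtension.of_injective φ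
  have hF : UniformlyColorable (wordDist S)
      (fun v : HNNExtension.Vertex φ => (fun g => QuotientGroup.mk g) ⁻¹' {v})
      (max n (m + 1) + 1) := by
    refine (uniformlyColorable_cosets hS hSf hSA hSAf HNNExtension.of hof hAn).mono
      (fun v => ⟨v.out, fun x hx => ?_⟩) (by omega)
    refine HNNExtension.mk_eq_mk_iff.1 ?_
    rw [QuotientGroup.out_eq']
    exact (show (QuotientGroup.mk x : HNNExtension.Vertex φ) = v from hx).symm
  have hE : UniformlyColorable (wordDist S)
      (fun v : HNNExtension.Vertex φ => {e ∈ gate (wordDist S) (fun g => QuotientGroup.mk g)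
        HNNExtension.parent v | 0 < HNNExtension.level v}) (max n (m + 1)) := by
    refine UniformlyColorable.mono (UniformlyColorable.of_or
      (uniformlyColorable_cosets hS hSf hSC hSCf (HNNExtension.of.comp i) (hof.comp hi) hCm)
      (uniformlyColorable_cosets hS hSf hSC hSCf (HNNExtension.of.comp j) (hof.comp hj) hCm)
      fun v => ?_) (fun v => ⟨v, subset_rfl⟩) (le_max_right n (m + 1))
    -- The base vertex is its own parent, so its gate is the whole fiber; the level condition
    -- discards it.
    by_cases hv : 0 < HNNExtension.level v
    · obtain ⟨g, u, hg⟩ := HNNExtension.exists_gate_subset hSA hv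
      refine ⟨g, ?_⟩
      rcases Int.units_eq_one_or u with rfl | rfl
      · left
        rintro e ⟨he, -⟩
        obtain ⟨_, ⟨y, rfl⟩, rfl⟩ := hg e he
        exact ⟨y, rfl⟩
      · right
        rintro e ⟨he, -⟩
        obtain ⟨_, ⟨y, rfl⟩, rfl⟩ := hg e he
        exact ⟨y, rfl⟩
    · exact ⟨1, Or.inl fun e he => absurd he.2 hv⟩
  have hX : UniformlyColorable (wordDist S) (fun _ : Unit => Set.univ) (max n (m + 1) + 1) := by
    intro r
    obtain ⟨D, hD⟩ := (HNNExtension.isTreeOfSpaces φ hSA).exists_coloring hF hE r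
    exact ⟨D, fun _ => hD⟩
  have hX' : UniformlyColorable (wordDist SG) (fun _ : Unit => Set.univ)
      (max n (m + 1) + 1) :=
    -- Change of generating set is the coset lemma for the identity homomorphism.
    (uniformlyColorable_cosets hSG hSGf hS hSf (MonoidHom.id _) Function.injective_id hX).mono
      (fun _ => ⟨1, fun x _ => ⟨x, by simp⟩⟩) le_rfl
  exact_mod_cast groupAsdim_le hSG hX'
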